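/- Let $M^n$ be a smooth Riemannian manifold with curvature tensor $R$, and let $g: M^n\to\mathbb{R}^{n+p}$ be a smooth isometric immersion with second fundamental form $\alpha: TM\times TM\to T_g^{\perp}M$. For $x\in M^n$ let $$\Gamma(x)=\{X\in T_xM : R(X,Y)=0 \ \ \forall\, Y\in T_xM\},\qquad \Delta_g(x)=\{X\in T_xM : \alpha(X,Y)=0\ \ \forall\, Y\in T_xM\}$$ be the nullity of $M^n$ and the relative nullity of $g$ at $x$, and set $\mu(x)=\dim\Gamma(x)$ and $\nu_g(x)=\dim\Delta_g(x)$. (One always has $\nu_g\le\mu\le\nu_g+p$, by Chern and Kuiper.) Suppose that the upper bound is attained, that is, $$\mu(x)=\nu_g(x)+p\qquad\text{for every } x\in M^n .$$ Then $M^n$ is flat, i.e. $R\equiv 0$. In particular, $\mu(x)=\nu_g(x)+p=n$ for every $x\in M^n$. -/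

import Mathlib

set_option maxSynthPendingDepth 3

open scoped ContDiff Manifold

namespace ChernKuiper

/-- Euclidean space `ℝⁿ` with its standard inner product. -/
abbrev Euc (n : ℕ) : Type := EuclideanSpace ℝ (Fin n)

/-- A (smooth) Riemannian metric on the `n`-dimensional smooth manifold `M`. -/
abbrev Metric (n : ℕ) (M : Type*) [TopologicalSpace M] [ChartedSpace (Euc n) M]
    [IsManifold (𝓡 n) ∞ M] : Type _ :=
  Bundle.ContMDiffRiemannianMetric (𝓡 n) ∞ (Euc n) (fun x : M => TangentSpace (𝓡 n) x)

/-! ### Christoffel symbols and curvature on an open subset of a vector space (such as `ℝⁿ`) -/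

section Local

variable {E : Type*} [NormedAddCommGroup E] [NormedSpace ℝ E]

/-- The Christoffel symbols of the first kind of `G = (G_y)` (a field of bilinear forms on `E`),
`(u, v, w) ↦ ½ (∂_u G(v, w) + ∂_v G(u, w) - ∂_w G(u, v))`; see `christoffelFirst_apply`. -/
noncomputable def christoffelFirst (G : E → E →L[ℝ] E →L[ℝ] ℝ) (y : E) :
    E →L[ℝ] E →L[ℝ] (E →L[ℝ] ℝ) :=
  let D : E →L[ℝ] E →L[ℝ] (E →L[ℝ] ℝ) := fderiv ℝ G y
  let T : (E →L[ℝ] E →L[ℝ] ℝ) →L[ℝ] (E →L[ℝ] E →L[ℝ] ℝ) :=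
    (ContinuousLinearMap.flipₗᵢ ℝ E E ℝ).toContinuousLinearEquiv
  (1 / 2 : ℝ) • (D + D.flip - T ∘L D.flip)

theorem christoffelFirst_apply (G : E → E →L[ℝ] E →L[ℝ] ℝ) (y u v w : E) :
    christoffelFirst G y u v w =
      1 / 2 * (fderiv ℝ G y u v w + fderiv ℝ G y v u w - fderiv ℝ G y w u v) := by
  simp [christoffelFirst]

/-- The Christoffel symbols (of the second kind) of a metric `G`: `Γ_y(u, v) ∈ E` is the vector
with `G_y(Γ_y(u, v), w) = ½ (∂_u G(v, w) + ∂_v G(u, w) - ∂_w G(u, v))` for all `w`. That is,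
`Γ_y(u, v) = ∇_u v` for the constant vector fields `u`, `v`, where `∇` is the Levi-Civita connection
of `G`. Here `G_y` is read as a map from `E` to its dual, and inverted. -/
noncomputable def christoffel (G : E → E →L[ℝ] E →L[ℝ] ℝ) (y : E) :
    E →L[ℝ] E →L[ℝ] E :=
  (ContinuousLinearMap.compL ℝ E (E →L[ℝ] ℝ) E (G y).inverse)
    ∘L christoffelFirst G y

theorem christoffel_apply (G : E → E →L[ℝ] E →L[ℝ] ℝ) (y u v : E) :
    christoffel G y u v = (G y).inverse (christoffelFirst G y u v) := rfl

/-- At a point where `G` is positive definite, the Christoffel symbols satisfy their defining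
equation. -/
theorem metric_christoffel [FiniteDimensional ℝ E] (G : E → E →L[ℝ] E →L[ℝ] ℝ) (y u v w : E)
    (hG : ∀ z, z ≠ 0 → 0 < G y z z) :
    G y (christoffel G y u v) w =
      1 / 2 * (fderiv ℝ G y u v w + fderiv ℝ G y v u w - fderiv ℝ G y w u v) := by
  have hinj : Function.Injective (G y) := by
    refine (injective_iff_map_eq_zero _).2 fun z hz => ?_
    by_contra h
    have := hG z h
    rw [hz] at this
    simp at this
  have hinv : (G y).IsInvertible := by
    have hfr : Module.finrank ℝ E = Module.finrank ℝ (E →L[ℝ] ℝ) := by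
      rw [← LinearMap.toContinuousLinearMap.finrank_eq (R := ℝ) (M := E →ₗ[ℝ] ℝ)]
      exact (Subspace.dual_finrank_eq (K := ℝ) (V := E)).symm
    exact ⟨(LinearEquiv.ofInjectiveOfFinrankEq (G y).toLinearMap hinj hfr).toContinuousLinearEquiv,
      by ext; rfl⟩
  rw [christoffel_apply, hinv.self_apply_inverse, christoffelFirst_apply]

/-- The curvature tensor of a metric `G`, with `R(u, v) w = ∇_u ∇_v w - ∇_v ∇_u w` for constant
vector fields `u`, `v`, `w`, i.e.
`R(u, v) w = (∂_u Γ)(v, w) - (∂_v Γ)(u, w) + Γ(u, Γ(v, w)) - Γ(v, Γ(u, w))`;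
see `localCurvature_apply`. -/
noncomputable def localCurvature (G : E → E →L[ℝ] E →L[ℝ] ℝ) (y : E) :
    E →ₗ[ℝ] E →ₗ[ℝ] E →ₗ[ℝ] E :=
  LinearMap.mk₂ ℝ
    (fun u v => (fderiv ℝ (christoffel G) y u v - fderiv ℝ (christoffel G) y v u
      + christoffel G y u ∘L christoffel G y v
      - christoffel G y v ∘L christoffel G y u).toLinearMap)
    (by intros; ext1; simp; abel) (by intros; ext1; simp [smul_add, smul_sub])
    (by intros; ext1; simp; abel) (by intros; ext1; simp [smul_add, smul_sub])

theorem localCurvature_apply (G : E → E →L[ℝ] E →L[ℝ] ℝ) (y u v w : E) :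
    localCurvature G y u v w =
      fderiv ℝ (christoffel G) y u v w - fderiv ℝ (christoffel G) y v u w
      + christoffel G y u (christoffel G y v w) - christoffel G y v (christoffel G y u w) := rfl

end Local

/-! ### The curvature tensor and the nullity of a Riemannian manifold -/

section Intrinsic

variable {n : ℕ} {M : Type*} [TopologicalSpace M] [ChartedSpace (Euc n) M] [IsManifold (𝓡 n) ∞ M]

/-- The coordinate expression of the metric `m` in the preferred chart `φ` at `x`:
`(G_y)(u, v) = m(d(φ⁻¹)_y u, d(φ⁻¹)_y v)` for `y` in the (open) image of `φ`. -/
noncomputable def chartMetric (m : Metric n M) (x : M) (y : Euc n) :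
    Euc n →L[ℝ] Euc n →L[ℝ] ℝ :=
  let q : M := (extChartAt (𝓡 n) x).symm y
  let B : Euc n →L[ℝ] Euc n →L[ℝ] ℝ := m.inner q
  let d : Euc n →L[ℝ] Euc n := mfderiv 𝓘(ℝ, Euc n) (𝓡 n) (extChartAt (𝓡 n) x).symm y
  B.bilinearComp d d

/-- The curvature tensor `R_x : T_xM × T_xM × T_xM → T_xM` of the Riemannian manifold `(M, m)`,
`(X, Y, Z) ↦ R(X, Y) Z`, computed in the preferred chart at `x`. (In Mathlib, `T_xM` is by
definition the space `ℝⁿ` of coordinate vectors with respect to the preferred chart at `x`.) -/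
noncomputable def curvature (m : Metric n M) (x : M) :
    TangentSpace (𝓡 n) x →ₗ[ℝ] TangentSpace (𝓡 n) x →ₗ[ℝ]
      TangentSpace (𝓡 n) x →ₗ[ℝ] TangentSpace (𝓡 n) x :=
  localCurvature (chartMetric m x) (extChartAt (𝓡 n) x x)

/-- `(M, m)` is flat: its curvature tensor vanishes identically. -/
def IsFlat (m : Metric n M) : Prop :=
  ∀ (x : M) (X Y Z : TangentSpace (𝓡 n) x), curvature m x X Y Z = 0

/-- The nullity `Γ(x) = {X ∈ T_xM : R(X, Y) = 0 for all Y ∈ T_xM}`. -/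
noncomputable def nullity (m : Metric n M) (x : M) : Submodule ℝ (TangentSpace (𝓡 n) x) where
  carrier := {X | ∀ Y : TangentSpace (𝓡 n) x, curvature m x X Y = 0}
  zero_mem' := by intro Y; simp
  add_mem' := by intro X X' h h' Y; simp [h Y, h' Y]
  smul_mem' := by intro c X h Y; simp [h Y]

/-- `μ(x) = dim Γ(x)`. -/
noncomputable def mu (m : Metric n M) (x : M) : ℕ := Module.finrank ℝ (nullity m x)

end Intrinsic

/-! ### Isometric immersions, second fundamental form and relative nullity -/

section Extrinsic

variable {n N : ℕ} {M : Type*} [TopologicalSpace M] [ChartedSpace (Euc n) M]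

/-- The differential `g_* : T_xM → ℝᴺ` of `g : M → ℝᴺ` at `x`. -/
noncomputable def differential (g : M → Euc N) (x : M) : TangentSpace (𝓡 n) x →L[ℝ] Euc N :=
  mfderiv (𝓡 n) 𝓘(ℝ, Euc N) g x

/-- `g : (M, m) → ℝᴺ` is a smooth isometric immersion. (Injectivity of the differential follows
from the positivity of `m`.) -/
def IsIsometricImmersion [IsManifold (𝓡 n) ∞ M] (m : Metric n M) (g : M → Euc N) : Prop :=
  ContMDiff (𝓡 n) 𝓘(ℝ, Euc N) ∞ g ∧
    ∀ (x : M) (X Y : TangentSpace (𝓡 n) x),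
      inner ℝ (differential (n := n) g x X) (differential (n := n) g x Y) = m.inner x X Y

/-- The component `(u, v) ↦ (B(u, v))_K ∈ K` in a subspace `K` of a bilinear map `B`. -/
noncomputable def normalComponent (K : Submodule ℝ (Euc N))
    (B : Euc n →L[ℝ] Euc n →L[ℝ] Euc N) : Euc n →ₗ[ℝ] Euc n →ₗ[ℝ] K :=
  LinearMap.mk₂ ℝ (fun u v => K.orthogonalProjectionOnto (B u v))
    (by intros; simp) (by intros; simp) (by intros; simp) (by intros; simp)

/-- The normal space `T_g^⊥M(x)`, the orthogonal complement of `g_* T_xM` in `ℝᴺ`. -/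
noncomputable def normalSpace (n : ℕ) {M : Type*} [TopologicalSpace M] [ChartedSpace (Euc n) M]
    (g : M → Euc N) (x : M) : Submodule ℝ (Euc N) :=
  (LinearMap.range (differential (n := n) g x).toLinearMap)ᗮ

/-- The second fundamental form `α_x : T_xM × T_xM → T_g^⊥M(x)`: the normal component of the second
derivative of `g`, read in the preferred chart `φ` at `x`. That is, `α(X, Y)` is the normal
component of the derivative in the direction `X` of `g_* Y`, where `Y` is extended to the vector
field with constant coordinates in the chart. -/
noncomputable def secondFundamentalForm (g : M → Euc N) (x : M) :
    TangentSpace (𝓡 n) x →ₗ[ℝ] TangentSpace (𝓡 n) x →ₗ[ℝ] normalSpace n g x :=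
  normalComponent (normalSpace n g x)
    (fderiv ℝ (fderiv ℝ (g ∘ (extChartAt (𝓡 n) x).symm)) (extChartAt (𝓡 n) x x))

/-- The relative nullity `Δ_g(x) = {X ∈ T_xM : α(X, Y) = 0 for all Y ∈ T_xM}`. -/
noncomputable def relativeNullity (g : M → Euc N) (x : M) :
    Submodule ℝ (TangentSpace (𝓡 n) x) where
  carrier := {X | ∀ Y : TangentSpace (𝓡 n) x, secondFundamentalForm g x X Y = 0}
  zero_mem' := by intro Y; simp
  add_mem' := by intro X X' h h' Y; simp [h Y, h' Y]
  smul_mem' := by intro c X h Y; simp [h Y]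

/-- `ν_g(x) = dim Δ_g(x)`. -/
noncomputable def nu (n : ℕ) {M : Type*} [TopologicalSpace M] [ChartedSpace (Euc n) M]
    (g : M → Euc N) (x : M) : ℕ :=
  Module.finrank ℝ (relativeNullity (n := n) g x)

end Extrinsic

end ChernKuiper

/-!
By the Gauss equation, the nullity `Γ` of `M` at `x` depends only on the second fundamental form
`α`: it consists of the `X` with `⟪α(X, Z), α(Y, U)⟫ = ⟪α(X, U), α(Y, Z)⟫` for all `Y`, `Z`, `U`.
In a chart, with Christoffel symbols `C` and `h = ∂∂f - f_* C`, which is `α` in coordinates, the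
Gauss equation is the tangential part of
`f_* R(u, v) w = ∂_v h(u, w) - ∂_u h(v, w) + h(v, C(u, w)) - h(u, C(v, w))`.

The restriction of `α` to `T_xM × Γ` is therefore a flat bilinear map in the sense of Moore. As the
normal space is positive definite, there is an `e` such that the kernel of `α(e, ·)` on `Γ` is
contained in `Δ`, and counting dimensions gives the inequality `μ ≤ ν + p` of Chern and Kuiper.

If equality holds, then `α(e, ·)` maps `Γ` onto the normal space, and flatness yields commuting
symmetric operators `B_Y` of the normal space with `B_Y α(e, X) = α(Y, X)` for `X ∈ Γ`. The Gauss
equation for vectors of `Γ` extends this to `α(Y, Z) = B_Z B_Y α(e, e)` for all `Y` and `Z`. Since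
the `B_Y` commute, `α` itself is flat, that is, `R = 0` at `x`.
-/

namespace ChernKuiper

open scoped InnerProductSpace Topology

section FlatBilinear

variable {S V W : Type*} [AddCommGroup S] [Module ℝ S] [AddCommGroup V] [Module ℝ V]
  [NormedAddCommGroup W] [InnerProductSpace ℝ W]

/-- A bilinear map `β` into an inner product space is *flat* (Moore) if
`⟪β(Y, X), β(Z, X')⟫ = ⟪β(Y, X'), β(Z, X)⟫`. If `β` is a second fundamental form, this is the Gauss
equation of a flat metric. -/
def IsFlatBilinear (β : V →ₗ[ℝ] S →ₗ[ℝ] W) : Prop :=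
  ∀ Y Z X X', ⟪β Y X, β Z X'⟫_ℝ = ⟪β Y X', β Z X⟫_ℝ

namespace IsFlatBilinear

variable {β : V →ₗ[ℝ] S →ₗ[ℝ] W}

/-- If every kernel `ker β(Z + tY)` contained a vector `K t` outside `ker β(Y)`, the vectors
`β(Y, K t)` would be nonzero and pairwise orthogonal for all the uncountably many `t`. -/
theorem exists_ker_add_smul_le [FiniteDimensional ℝ W] (hβ : IsFlatBilinear β) (Y Z : V) :
    ∃ t : ℝ, LinearMap.ker (β (Z + t • Y)) ≤ LinearMap.ker (β Y) := by
  by_contra! h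
  simp only [SetLike.not_le_iff_exists, LinearMap.mem_ker] at h
  choose K hK hYK using h
  have hZK (t : ℝ) : β Z (K t) = -(t • β Y (K t)) := by
    rw [← add_eq_zero_iff_eq_neg, ← hK t]
    simp
  have horth : Pairwise fun s t => ⟪β Y (K s), β Y (K t)⟫_ℝ = 0 := fun s t hst => by
    have hflat := hβ Y Z (K s) (K t)
    rw [hZK, hZK, inner_neg_right, inner_neg_right, real_inner_smul_right, real_inner_smul_right,
      real_inner_comm (β Y (K s)) (β Y (K t))] at hflat
    have hprod : (s - t) * ⟪β Y (K s), β Y (K t)⟫_ℝ = 0 := by linarith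
    exact (mul_eq_zero.1 hprod).resolve_left (sub_ne_zero.2 hst)
  have : Finite ℝ := (linearIndependent_of_ne_zero_of_inner_eq_zero hYK horth).finite
  exact not_finite ℝ

theorem exists_ker_le [FiniteDimensional ℝ S] [FiniteDimensional ℝ W] (hβ : IsFlatBilinear β) :
    ∃ e : V, ∀ Y, LinearMap.ker (β e) ≤ LinearMap.ker (β Y) := by
  let e : V := Function.argmin fun Z => LinearMap.ker (β Z)
  refine ⟨e, fun Y => ?_⟩
  obtain ⟨t, ht⟩ := hβ.exists_ker_add_smul_le Y e
  have hle : LinearMap.ker (β (e + t • Y)) ≤ LinearMap.ker (β e) := fun X hX => by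
    have hYX : β Y X = 0 := ht hX
    simpa [hYX] using hX
  have heq : LinearMap.ker (β (e + t • Y)) = LinearMap.ker (β e) :=
    hle.eq_of_not_lt (Function.not_lt_argmin (fun Z => LinearMap.ker (β Z)) _)
  exact heq ▸ ht

theorem ker_le_of_surjective (hβ : IsFlatBilinear β) {e : V} (he : Function.Surjective (β e))
    (Y : V) : LinearMap.ker (β e) ≤ LinearMap.ker (β Y) := fun X hX => by
  obtain ⟨X', hX'⟩ := he (β Y X)
  rw [LinearMap.mem_ker, ← inner_self_eq_zero (𝕜 := ℝ)]
  nth_rw 2 [← hX']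
  rw [hβ, LinearMap.mem_ker.1 hX, inner_zero_right]

theorem exists_isSymmetric_commute (hβ : IsFlatBilinear β) {e : V}
    (he : Function.Surjective (β e)) :
    ∃ B : V → W →ₗ[ℝ] W, (∀ Y, (B Y).IsSymmetric) ∧ (∀ Y Z, Commute (B Y) (B Z)) ∧
      ∀ Y X, B Y (β e X) = β Y X := by
  obtain ⟨s, hs⟩ := (β e).exists_rightInverse_of_surjective (LinearMap.range_eq_top.2 he)
  let B (Y : V) : W →ₗ[ℝ] W := β Y ∘ₗ s
  have hB (Y : V) (X : S) : B Y (β e X) = β Y X := by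
    have hker : s (β e X) - X ∈ LinearMap.ker (β e) := by
      rw [LinearMap.mem_ker, map_sub, sub_eq_zero]
      exact LinearMap.congr_fun hs (β e X)
    exact LinearMap.sub_mem_ker_iff.1 (hβ.ker_le_of_surjective he Y hker)
  have hsymm (Y : V) : (B Y).IsSymmetric := fun w w' => by
    obtain ⟨X, rfl⟩ := he w
    obtain ⟨X', rfl⟩ := he w'
    rw [hB, hB, hβ, real_inner_comm]
  refine ⟨B, hsymm, fun Y Z => ?_, hB⟩
  refine LinearMap.ext fun w => ext_inner_right ℝ fun w' => ?_
  obtain ⟨X, rfl⟩ := he w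
  obtain ⟨X', rfl⟩ := he w'
  calc ⟪B Y (B Z (β e X)), β e X'⟫_ℝ = ⟪β Z X, β Y X'⟫_ℝ := by rw [hsymm Y, hB, hB]
    _ = ⟪β Y X, β Z X'⟫_ℝ := by rw [hβ, real_inner_comm]
    _ = ⟪B Z (B Y (β e X)), β e X'⟫_ℝ := by rw [hsymm Z, hB, hB]

end IsFlatBilinear

theorem isFlatBilinear_of_commute {α : V →ₗ[ℝ] V →ₗ[ℝ] W} {B : V → W →ₗ[ℝ] W}
    (hsymm : ∀ Y, (B Y).IsSymmetric) (hcomm : ∀ Y Z, Commute (B Y) (B Z)) (η : W)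
    (hα : ∀ Y Z, α Y Z = B Z (B Y η)) : IsFlatBilinear α := fun Y Z X X' => by
  have hswap (w : W) : B X (B X' w) = B X' (B X w) := LinearMap.congr_fun (hcomm X X') w
  rw [hα, hα, hα, hα, hsymm X, hsymm X', hswap]

/-- The *Gauss nullity* of a bilinear map `α`: the vectors `X` with
`⟪α(X, Z), α(Y, U)⟫ = ⟪α(X, U), α(Y, Z)⟫` for all `Y`, `Z`, `U`. By the Gauss equation, the Gauss
nullity of a second fundamental form is the nullity of the curvature tensor. -/
def gaussNullity (α : V →ₗ[ℝ] V →ₗ[ℝ] W) : Submodule ℝ V where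
  carrier := {X | ∀ Y Z U, ⟪α X Z, α Y U⟫_ℝ = ⟪α X U, α Y Z⟫_ℝ}
  zero_mem' := by simp
  add_mem' hX hX' Y Z U := by simp [inner_add_left, hX Y Z U, hX' Y Z U]
  smul_mem' c X hX Y Z U := by simp [real_inner_smul_left, hX Y Z U]

/-- The map `(Y, X) ↦ α(X, Y)` with `X` in the Gauss nullity of `α`. The arguments are swapped so
that its partial maps have domain `gaussNullity α`. -/
def restrictGaussNullity (α : V →ₗ[ℝ] V →ₗ[ℝ] W) : V →ₗ[ℝ] gaussNullity α →ₗ[ℝ] W :=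
  (α.domRestrict (gaussNullity α)).flip

variable (α : V →ₗ[ℝ] V →ₗ[ℝ] W)

theorem isFlatBilinear_restrictGaussNullity : IsFlatBilinear (restrictGaussNullity α) :=
  fun Y Z X X' => (X.2 X' Y Z).trans (real_inner_comm _ _)

theorem exists_finrank_ker_restrictGaussNullity_le [FiniteDimensional ℝ V]
    [FiniteDimensional ℝ W] :
    ∃ e : V, Module.finrank ℝ (LinearMap.ker (restrictGaussNullity α e)) ≤
      Module.finrank ℝ (LinearMap.ker α) := by
  obtain ⟨e, he⟩ := (isFlatBilinear_restrictGaussNullity α).exists_ker_le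
  refine ⟨e, ?_⟩
  rw [← Submodule.finrank_map_subtype_eq]
  refine Submodule.finrank_mono ?_
  rintro _ ⟨X, hX, rfl⟩
  exact LinearMap.ext fun Y => he Y hX

theorem finrank_gaussNullity_le [FiniteDimensional ℝ V] [FiniteDimensional ℝ W] :
    Module.finrank ℝ (gaussNullity α) ≤
      Module.finrank ℝ (LinearMap.ker α) + Module.finrank ℝ W := by
  obtain ⟨e, he⟩ := exists_finrank_ker_restrictGaussNullity_le α
  have hrank := (restrictGaussNullity α e).finrank_range_add_finrank_ker
  have hrange := Submodule.finrank_le (LinearMap.range (restrictGaussNullity α e))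
  omega

theorem exists_surjective_restrictGaussNullity [FiniteDimensional ℝ V] [FiniteDimensional ℝ W]
    (hdim : Module.finrank ℝ (LinearMap.ker α) + Module.finrank ℝ W ≤
      Module.finrank ℝ (gaussNullity α)) :
    ∃ e : V, Function.Surjective (restrictGaussNullity α e) := by
  obtain ⟨e, he⟩ := exists_finrank_ker_restrictGaussNullity_le α
  refine ⟨e, LinearMap.range_eq_top.1 (Submodule.eq_top_of_finrank_eq ?_)⟩
  have hrank := (restrictGaussNullity α e).finrank_range_add_finrank_ker
  have hrange := Submodule.finrank_le (LinearMap.range (restrictGaussNullity α e))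
  omega

variable {α}

theorem isFlatBilinear_of_surjective_restrictGaussNullity (hα : ∀ X Y, α X Y = α Y X) {e : V}
    (he : Function.Surjective (restrictGaussNullity α e)) : IsFlatBilinear α := by
  obtain ⟨B, hsymm, hcomm, hB⟩ :=
    (isFlatBilinear_restrictGaussNullity α).exists_isSymmetric_commute he
  have hfactor (Y U : V) : α Y U = B U (α Y e) := by
    refine ext_inner_left ℝ fun w => ?_
    obtain ⟨X, rfl⟩ := he w
    rw [← hsymm U, hB]
    exact X.2 Y e U
  refine isFlatBilinear_of_commute hsymm hcomm (α e e) fun Y Z => ?_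
  rw [hfactor Y Z, hα Y e, hfactor e Y]

theorem isFlatBilinear_of_finrank_le [FiniteDimensional ℝ V] [FiniteDimensional ℝ W]
    (hα : ∀ X Y, α X Y = α Y X)
    (hdim : Module.finrank ℝ (LinearMap.ker α) + Module.finrank ℝ W ≤
      Module.finrank ℝ (gaussNullity α)) : IsFlatBilinear α := by
  obtain ⟨e, he⟩ := exists_surjective_restrictGaussNullity α hdim
  exact isFlatBilinear_of_surjective_restrictGaussNullity hα he

theorem gaussNullity_eq_top_iff : gaussNullity α = ⊤ ↔ IsFlatBilinear α :=
  Submodule.eq_top_iff'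

end FlatBilinear

section Calculus

variable {𝕜 E₀ E₁ E₂ F : Type*} [NontriviallyNormedField 𝕜]
  [NormedAddCommGroup E₀] [NormedSpace 𝕜 E₀] [NormedAddCommGroup E₁] [NormedSpace 𝕜 E₁]
  [NormedAddCommGroup E₂] [NormedSpace 𝕜 E₂] [NormedAddCommGroup F] [NormedSpace 𝕜 F] {y : E₀}

theorem fderiv_apply_const {A : E₀ → E₁ →L[𝕜] F} (hA : DifferentiableAt 𝕜 A y) (u : E₀) (v : E₁) :
    fderiv 𝕜 (fun z => A z v) y u = fderiv 𝕜 A y u v := by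
  rw [fderiv_clm_apply hA (differentiableAt_const v)]
  simp

theorem fderiv_apply_const_apply_const {B : E₀ → E₁ →L[𝕜] E₂ →L[𝕜] F}
    (hB : DifferentiableAt 𝕜 B y) (u : E₀) (v : E₁) (w : E₂) :
    fderiv 𝕜 (fun z => B z v w) y u = fderiv 𝕜 B y u v w := by
  rw [fderiv_apply_const (hB.clm_apply (differentiableAt_const v)), fderiv_apply_const hB]

theorem differentiableAt_fderiv {f : E₀ → F} (hf : ContDiffAt 𝕜 2 f y) :
    DifferentiableAt 𝕜 (fderiv 𝕜 f) y :=
  (hf.fderiv_right (m := 1) le_rfl).differentiableAt one_ne_zero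

end Calculus

section Gauss

variable {E : Type*} [NormedAddCommGroup E] [NormedSpace ℝ E]

theorem isInvertible_of_forall_pos [FiniteDimensional ℝ E] {B : E →L[ℝ] E →L[ℝ] ℝ}
    (hB : ∀ z, z ≠ 0 → 0 < B z z) : B.IsInvertible := by
  have hinj : Function.Injective B := (injective_iff_map_eq_zero B).2 fun z hz => by
    by_contra hz0
    exact (hB z hz0).ne' (by rw [hz, zero_apply])
  have hfinrank : Module.finrank ℝ E = Module.finrank ℝ (E →L[ℝ] ℝ) :=
    Subspace.dual_finrank_eq.symm.trans LinearMap.toContinuousLinearMap.finrank_eq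
  exact ⟨(B.toLinearMap.linearEquivOfInjective hinj hfinrank).toContinuousLinearEquiv, rfl⟩

theorem fderiv_fderiv_comm {F : Type*} [NormedAddCommGroup F] [NormedSpace ℝ F] {f : E → F} {y : E}
    (hf : ContDiffAt ℝ 2 f y) (u v : E) :
    fderiv ℝ (fderiv ℝ f) y u v = fderiv ℝ (fderiv ℝ f) y v u :=
  (hf.isSymmSndFDerivAt (by simp)).eq u v

section Congr

variable {G H : E → E →L[ℝ] E →L[ℝ] ℝ} {y : E}

theorem christoffel_congr (h : G =ᶠ[𝓝 y] H) : christoffel G y = christoffel H y := by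
  rw [christoffel, christoffel, christoffelFirst, christoffelFirst, h.fderiv_eq, h.eq_of_nhds]

theorem localCurvature_congr (h : G =ᶠ[𝓝 y] H) : localCurvature G y = localCurvature H y := by
  have hchristoffel : christoffel G =ᶠ[𝓝 y] christoffel H :=
    h.eventuallyEq_nhds.mono fun _ => christoffel_congr
  ext u v w
  rw [localCurvature_apply, localCurvature_apply, hchristoffel.fderiv_eq, hchristoffel.eq_of_nhds]

end Congr

section Differentiability

variable {G : E → E →L[ℝ] E →L[ℝ] ℝ} {y : E}

theorem differentiableAt_christoffelFirst (hG : ContDiffAt ℝ 2 G y) :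
    DifferentiableAt ℝ (christoffelFirst G) y := by
  have hD : DifferentiableAt ℝ (fderiv ℝ G) y :=
    (hG.fderiv_right (m := 1) le_rfl).differentiableAt one_ne_zero
  have hflip : DifferentiableAt ℝ (fun z => (fderiv ℝ G z).flip) y :=
    (ContinuousLinearMap.flipₗᵢ ℝ E E (E →L[ℝ] ℝ)).toContinuousLinearEquiv.differentiableAt.comp
      y hD
  exact ((hD.add hflip).sub ((differentiableAt_const _).clm_comp hflip)).const_smul (1 / 2 : ℝ)

theorem differentiableAt_christoffel [FiniteDimensional ℝ E] (hG : ContDiffAt ℝ 2 G y)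
    (hpos : ∀ z, z ≠ 0 → 0 < G y z z) : DifferentiableAt ℝ (christoffel G) y := by
  have : CompleteSpace E := FiniteDimensional.complete ℝ E
  have hinverse : DifferentiableAt ℝ (fun z => (G z).inverse) y :=
    ((isInvertible_of_forall_pos hpos).contDiffAt_map_inverse.differentiableAt one_ne_zero).comp y
      (hG.differentiableAt two_ne_zero)
  exact ((ContinuousLinearMap.compL ℝ E (E →L[ℝ] ℝ) E).differentiableAt.comp y hinverse).clm_comp
    (differentiableAt_christoffelFirst hG)

end Differentiability

variable {F : Type*} [NormedAddCommGroup F] [InnerProductSpace ℝ F]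

/-- The metric `⟪f_* u, f_* v⟫` induced on `E` by a map `f` into an inner product space; it is
positive definite where `f` is an immersion. -/
noncomputable def inducedMetric (f : E → F) (y : E) : E →L[ℝ] E →L[ℝ] ℝ :=
  (innerSL ℝ).bilinearComp (fderiv ℝ f y) (fderiv ℝ f y)

/-- The second covariant derivative `h(u, v) = ∂_u ∂_v f - f_* Γ(u, v)` of a map `f` with respect to
its induced metric. Where `f` is an immersion, `h` is the second fundamental form of `f`, see
`inner_normalHessian_fderiv`. -/
noncomputable def normalHessian (f : E → F) (y : E) : E →L[ℝ] E →L[ℝ] F :=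
  fderiv ℝ (fderiv ℝ f) y -
    ContinuousLinearMap.compL ℝ E E F (fderiv ℝ f y) ∘L christoffel (inducedMetric f) y

variable {f : E → F} {y : E}

theorem inducedMetric_apply (f : E → F) (y u v : E) :
    inducedMetric f y u v = ⟪fderiv ℝ f y u, fderiv ℝ f y v⟫_ℝ := rfl

theorem normalHessian_apply (f : E → F) (y u v : E) :
    normalHessian f y u v =
      fderiv ℝ (fderiv ℝ f) y u v - fderiv ℝ f y (christoffel (inducedMetric f) y u v) := rfl

theorem inducedMetric_self_pos (hinj : Function.Injective (fderiv ℝ f y)) {z : E} (hz : z ≠ 0) :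
    0 < inducedMetric f y z z :=
  real_inner_self_pos.2 ((map_ne_zero_iff _ hinj).2 hz)

theorem contDiffAt_inducedMetric (hf : ContDiffAt ℝ 3 f y) :
    ContDiffAt ℝ 2 (inducedMetric f) y := by
  have hD : ContDiffAt ℝ 2 (fderiv ℝ f) y := hf.fderiv_right le_rfl
  have hcomp : ContDiffAt ℝ 2 (fun z => innerSL ℝ ∘L fderiv ℝ f z) y := contDiffAt_const.clm_comp hD
  have hflip : ContDiffAt ℝ 2 (fun z => (innerSL ℝ ∘L fderiv ℝ f z).flip) y :=
    (ContinuousLinearMap.flipₗᵢ ℝ E F ℝ).contDiff.contDiffAt.comp y hcomp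
  exact (ContinuousLinearMap.flipₗᵢ ℝ E E ℝ).contDiff.contDiffAt.comp y (hflip.clm_comp hD)

theorem fderiv_inducedMetric (hf : ContDiffAt ℝ 3 f y) (u v w : E) :
    fderiv ℝ (inducedMetric f) y u v w =
      ⟪fderiv ℝ (fderiv ℝ f) y u v, fderiv ℝ f y w⟫_ℝ +
        ⟪fderiv ℝ f y v, fderiv ℝ (fderiv ℝ f) y u w⟫_ℝ := by
  have hD := differentiableAt_fderiv (hf.of_le (by norm_num))
  have hG := (contDiffAt_inducedMetric hf).differentiableAt two_ne_zero
  calc fderiv ℝ (inducedMetric f) y u v w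
      = fderiv ℝ (fun z => inducedMetric f z v w) y u := by
        rw [fderiv_apply_const_apply_const hG]
    _ = fderiv ℝ (fun z => ⟪fderiv ℝ f z v, fderiv ℝ f z w⟫_ℝ) y u := rfl
    _ = _ := by
        rw [fderiv_inner_apply ℝ (by fun_prop) (by fun_prop), fderiv_apply_const hD,
          fderiv_apply_const hD, add_comm]

variable [FiniteDimensional ℝ E]

theorem inner_normalHessian_fderiv (hf : ContDiffAt ℝ 3 f y)
    (hinj : Function.Injective (fderiv ℝ f y)) (u v w : E) :
    ⟪normalHessian f y u v, fderiv ℝ f y w⟫_ℝ = 0 := by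
  have hf2 : ContDiffAt ℝ 2 f y := hf.of_le (by norm_num)
  have hkoszul := metric_christoffel (inducedMetric f) y u v w fun z =>
    inducedMetric_self_pos hinj
  rw [inducedMetric_apply, fderiv_inducedMetric hf, fderiv_inducedMetric hf,
    fderiv_inducedMetric hf, fderiv_fderiv_comm hf2 v u, fderiv_fderiv_comm hf2 w u,
    fderiv_fderiv_comm hf2 w v] at hkoszul
  rw [normalHessian_apply, inner_sub_left, hkoszul, real_inner_comm _ (fderiv ℝ f y v)]
  ring

theorem inner_normalHessian_fderiv_fderiv (hf : ContDiffAt ℝ 3 f y)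
    (hinj : Function.Injective (fderiv ℝ f y)) (u v w z : E) :
    ⟪normalHessian f y u v, fderiv ℝ (fderiv ℝ f) y w z⟫_ℝ =
      ⟪normalHessian f y u v, normalHessian f y w z⟫_ℝ := by
  rw [normalHessian_apply f y w z, inner_sub_right, inner_normalHessian_fderiv hf hinj, sub_zero]

theorem differentiableAt_christoffel_inducedMetric (hf : ContDiffAt ℝ 3 f y)
    (hinj : Function.Injective (fderiv ℝ f y)) :
    DifferentiableAt ℝ (christoffel (inducedMetric f)) y :=
  differentiableAt_christoffel (contDiffAt_inducedMetric hf) fun _ => inducedMetric_self_pos hinj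

theorem differentiableAt_normalHessian (hf : ContDiffAt ℝ 3 f y)
    (hinj : Function.Injective (fderiv ℝ f y)) : DifferentiableAt ℝ (normalHessian f) y := by
  have hD := differentiableAt_fderiv (hf.of_le (by norm_num))
  have hDD := differentiableAt_fderiv (hf.fderiv_right (m := 2) le_rfl)
  have hΓ := differentiableAt_christoffel_inducedMetric hf hinj
  exact hDD.sub (((ContinuousLinearMap.compL ℝ E E F).differentiableAt.comp y hD).clm_comp hΓ)

theorem fderiv_normalHessian (hf : ContDiffAt ℝ 3 f y)
    (hinj : Function.Injective (fderiv ℝ f y)) (u v w : E) :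
    fderiv ℝ (normalHessian f) y u v w =
      fderiv ℝ (fderiv ℝ (fderiv ℝ f)) y u v w
        - fderiv ℝ (fderiv ℝ f) y u (christoffel (inducedMetric f) y v w)
        - fderiv ℝ f y (fderiv ℝ (christoffel (inducedMetric f)) y u v w) := by
  have hD := differentiableAt_fderiv (hf.of_le (by norm_num))
  have hDD := differentiableAt_fderiv (hf.fderiv_right (m := 2) le_rfl)
  have hΓ := differentiableAt_christoffel_inducedMetric hf hinj
  calc fderiv ℝ (normalHessian f) y u v w
      = fderiv ℝ (fun x => fderiv ℝ (fderiv ℝ f) x v w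
          - fderiv ℝ f x (christoffel (inducedMetric f) x v w)) y u :=
        (fderiv_apply_const_apply_const (differentiableAt_normalHessian hf hinj) u v w).symm
    _ = _ := by
        rw [fderiv_fun_sub (by fun_prop) (by fun_prop), sub_apply,
          fderiv_apply_const_apply_const hDD, fderiv_clm_apply hD (by fun_prop), add_apply,
          ContinuousLinearMap.comp_apply, ContinuousLinearMap.flip_apply,
          fderiv_apply_const_apply_const hΓ]
        abel

/-- Differentiating `⟪h(v, w), f_* z⟫ = 0` in the direction `u`. -/
theorem inner_fderiv_normalHessian_fderiv (hf : ContDiffAt ℝ 3 f y)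
    (hinj : Function.Injective (fderiv ℝ f y)) (u v w z : E) :
    ⟪fderiv ℝ (normalHessian f) y u v w, fderiv ℝ f y z⟫_ℝ =
      -⟪normalHessian f y v w, normalHessian f y u z⟫_ℝ := by
  have hD := differentiableAt_fderiv (hf.of_le (by norm_num))
  have hh := differentiableAt_normalHessian hf hinj
  have hinj' : ∀ᶠ x in 𝓝 y, Function.Injective (fderiv ℝ f x) :=
    hD.continuousAt.eventually (ContinuousLinearMap.isOpen_injective.mem_nhds hinj)
  have htangent : (fun x => ⟪normalHessian f x v w, fderiv ℝ f x z⟫_ℝ) =ᶠ[𝓝 y] fun _ => 0 := by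
    filter_upwards [hf.eventually (by simp), hinj'] with x hfx hinjx
      using inner_normalHessian_fderiv hfx hinjx v w z
  have hderiv : fderiv ℝ (fun x => ⟪normalHessian f x v w, fderiv ℝ f x z⟫_ℝ) y u = 0 := by
    simp [htangent.fderiv_eq]
  rw [fderiv_inner_apply ℝ (by fun_prop) (by fun_prop), fderiv_apply_const hD,
    fderiv_apply_const_apply_const hh, inner_normalHessian_fderiv_fderiv hf hinj] at hderiv
  exact eq_neg_of_add_eq_zero_right hderiv

theorem fderiv_localCurvature_inducedMetric (hf : ContDiffAt ℝ 3 f y)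
    (hinj : Function.Injective (fderiv ℝ f y)) (u v w : E) :
    fderiv ℝ f y (localCurvature (inducedMetric f) y u v w) =
      fderiv ℝ (normalHessian f) y v u w - fderiv ℝ (normalHessian f) y u v w
        + normalHessian f y v (christoffel (inducedMetric f) y u w)
        - normalHessian f y u (christoffel (inducedMetric f) y v w) := by
  have hD2 : ContDiffAt ℝ 2 (fderiv ℝ f) y := hf.fderiv_right le_rfl
  rw [fderiv_normalHessian hf hinj, fderiv_normalHessian hf hinj, fderiv_fderiv_comm hD2 v u,
    localCurvature_apply, normalHessian_apply, normalHessian_apply]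
  simp only [map_add, map_sub]
  abel

theorem gauss_equation (hf : ContDiffAt ℝ 3 f y) (hinj : Function.Injective (fderiv ℝ f y))
    (u v w z : E) :
    ⟪fderiv ℝ f y (localCurvature (inducedMetric f) y u v w), fderiv ℝ f y z⟫_ℝ =
      ⟪normalHessian f y v w, normalHessian f y u z⟫_ℝ -
        ⟪normalHessian f y u w, normalHessian f y v z⟫_ℝ := by
  rw [fderiv_localCurvature_inducedMetric hf hinj, inner_sub_left, inner_add_left, inner_sub_left,
    inner_fderiv_normalHessian_fderiv hf hinj, inner_fderiv_normalHessian_fderiv hf hinj,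
    inner_normalHessian_fderiv hf hinj, inner_normalHessian_fderiv hf hinj]
  ring

end Gauss

section Manifold

variable {n N : ℕ} {M : Type*} [TopologicalSpace M] [ChartedSpace (Euc n) M]

/-- The coordinate expression `g ∘ φ⁻¹` of `g : M → ℝᴺ` in the preferred chart `φ` at `x`. -/
noncomputable def coordExpr (g : M → Euc N) (x : M) : Euc n → Euc N :=
  g ∘ (extChartAt (𝓡 n) x).symm

instance (x : M) : FiniteDimensional ℝ (TangentSpace (𝓡 n) x) :=
  inferInstanceAs (FiniteDimensional ℝ (Euc n))

theorem finrank_tangentSpace (x : M) : Module.finrank ℝ (TangentSpace (𝓡 n) x) = n :=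
  finrank_euclideanSpace_fin

theorem relativeNullity_eq_ker (g : M → Euc N) (x : M) :
    relativeNullity (n := n) g x = LinearMap.ker (secondFundamentalForm g x) :=
  Submodule.ext fun X =>
    (LinearMap.ext_iff (f := secondFundamentalForm g x X) (g := 0)).symm

variable [IsManifold (𝓡 n) ∞ M]

theorem contMDiffAt_extChartAt_symm (x : M) {y : Euc n} (hy : y ∈ (extChartAt (𝓡 n) x).target) :
    ContMDiffAt 𝓘(ℝ, Euc n) (𝓡 n) ∞ (extChartAt (𝓡 n) x).symm y :=
  (contMDiffOn_extChartAt_symm x).contMDiffAt ((isOpen_extChartAt_target x).mem_nhds hy)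

theorem mfderiv_extChartAt_symm_injective (x : M) {y : Euc n}
    (hy : y ∈ (extChartAt (𝓡 n) x).target) :
    Function.Injective (mfderiv 𝓘(ℝ, Euc n) (𝓡 n) (extChartAt (𝓡 n) x).symm y) := by
  have : IsManifold (𝓡 n) 1 M := IsManifold.of_le (n := ∞) (by simp)
  have h := isInvertible_mfderivWithin_extChartAt_symm (I := 𝓡 n) hy
  rw [ModelWithCorners.range_eq_univ, mfderivWithin_univ] at h
  exact h.injective

namespace IsIsometricImmersion

variable {m : Metric n M} {g : M → Euc N}

theorem contDiffAt_coordExpr (hg : IsIsometricImmersion m g) (x : M) {y : Euc n}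
    (hy : y ∈ (extChartAt (𝓡 n) x).target) : ContDiffAt ℝ ∞ (coordExpr g x) y :=
  contMDiffAt_iff_contDiffAt.1 (hg.1.contMDiffAt.comp y (contMDiffAt_extChartAt_symm x hy))

theorem fderiv_coordExpr_apply (hg : IsIsometricImmersion m g) (x : M) {y : Euc n}
    (hy : y ∈ (extChartAt (𝓡 n) x).target) (u : Euc n) :
    fderiv ℝ (coordExpr g x) y u =
      differential g ((extChartAt (𝓡 n) x).symm y)
        (mfderiv 𝓘(ℝ, Euc n) (𝓡 n) (extChartAt (𝓡 n) x).symm y u) := by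
  rw [← mfderiv_eq_fderiv, coordExpr, mfderiv_comp (I' := 𝓡 n) y
    (hg.1.contMDiffAt.mdifferentiableAt (by simp))
    ((contMDiffAt_extChartAt_symm x hy).mdifferentiableAt (by simp))]
  rfl

theorem differential_eq_fderiv_coordExpr (hg : IsIsometricImmersion m g) (x : M) :
    differential (n := n) g x = fderiv ℝ (coordExpr g x) (extChartAt (𝓡 n) x x) := by
  have h : MDifferentiableAt (𝓡 n) 𝓘(ℝ, Euc N) g x := hg.1.contMDiffAt.mdifferentiableAt (by simp)
  rw [differential, h.mfderiv, ModelWithCorners.range_eq_univ, fderivWithin_univ]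
  rfl

theorem differential_injective (hg : IsIsometricImmersion m g) (x : M) :
    Function.Injective (differential (n := n) g x) :=
  (injective_iff_map_eq_zero _).2 fun X hX => by
    by_contra hX0
    exact (m.pos x X hX0).ne' (by rw [← hg.2, hX, inner_zero_left])

theorem fderiv_coordExpr_injective (hg : IsIsometricImmersion m g) (x : M) {y : Euc n}
    (hy : y ∈ (extChartAt (𝓡 n) x).target) :
    Function.Injective (fderiv ℝ (coordExpr g x) y) := fun u v huv => by
  rw [hg.fderiv_coordExpr_apply x hy, hg.fderiv_coordExpr_apply x hy] at huv
  exact mfderiv_extChartAt_symm_injective x hy (hg.differential_injective _ huv)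

theorem chartMetric_eq_inducedMetric (hg : IsIsometricImmersion m g) (x : M) {y : Euc n}
    (hy : y ∈ (extChartAt (𝓡 n) x).target) :
    chartMetric m x y = inducedMetric (coordExpr g x) y := by
  ext u v
  rw [inducedMetric_apply, hg.fderiv_coordExpr_apply x hy, hg.fderiv_coordExpr_apply x hy, hg.2]
  rfl

theorem curvature_eq_localCurvature (hg : IsIsometricImmersion m g) (x : M) :
    curvature m x = localCurvature (inducedMetric (coordExpr g x)) (extChartAt (𝓡 n) x x) := by
  refine localCurvature_congr ?_
  filter_upwards [extChartAt_target_mem_nhds (I := 𝓡 n) x] with y hy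
    using hg.chartMetric_eq_inducedMetric x hy

theorem coe_secondFundamentalForm (hg : IsIsometricImmersion m g) (x : M)
    (X Y : TangentSpace (𝓡 n) x) :
    (secondFundamentalForm g x X Y : Euc N) =
      normalHessian (coordExpr g x) (extChartAt (𝓡 n) x x) X Y := by
  have hx := mem_extChartAt_target (I := 𝓡 n) x
  refine (Submodule.coe_orthogonalProjectionOnto_apply _ _).trans
    (Submodule.eq_starProjection_of_mem_orthogonal ?_ ?_)
  · rw [normalSpace, Submodule.mem_orthogonal']
    rintro _ ⟨Z, rfl⟩
    rw [hg.differential_eq_fderiv_coordExpr]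
    exact inner_normalHessian_fderiv ((hg.contDiffAt_coordExpr x hx).of_le ENat.LEInfty.out)
      (hg.fderiv_coordExpr_injective x hx) X Y Z
  · rw [normalSpace, Submodule.orthogonal_orthogonal, hg.differential_eq_fderiv_coordExpr]
    exact ⟨_, (sub_sub_cancel _ _).symm⟩

theorem secondFundamentalForm_comm (hg : IsIsometricImmersion m g) (x : M)
    (X Y : TangentSpace (𝓡 n) x) :
    secondFundamentalForm g x X Y = secondFundamentalForm g x Y X :=
  congrArg (normalSpace n g x).orthogonalProjectionOnto <| fderiv_fderiv_comm
    ((hg.contDiffAt_coordExpr x (mem_extChartAt_target x)).of_le ENat.LEInfty.out) X Y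

theorem inner_curvature (hg : IsIsometricImmersion m g) (x : M)
    (X Y Z U : TangentSpace (𝓡 n) x) :
    m.inner x (curvature m x X Y Z) U =
      ⟪secondFundamentalForm g x Y Z, secondFundamentalForm g x X U⟫_ℝ -
        ⟪secondFundamentalForm g x X Z, secondFundamentalForm g x Y U⟫_ℝ := by
  have hx := mem_extChartAt_target (I := 𝓡 n) x
  simp only [← hg.2, hg.curvature_eq_localCurvature, hg.differential_eq_fderiv_coordExpr,
    Submodule.coe_inner, hg.coe_secondFundamentalForm]
  exact gauss_equation ((hg.contDiffAt_coordExpr x hx).of_le ENat.LEInfty.out)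
    (hg.fderiv_coordExpr_injective x hx) X Y Z U

theorem curvature_eq_zero_iff (hg : IsIsometricImmersion m g) (x : M)
    (X Y Z : TangentSpace (𝓡 n) x) :
    curvature m x X Y Z = 0 ↔ ∀ U,
      ⟪secondFundamentalForm g x X Z, secondFundamentalForm g x Y U⟫_ℝ =
        ⟪secondFundamentalForm g x X U, secondFundamentalForm g x Y Z⟫_ℝ := by
  have hinner (U : TangentSpace (𝓡 n) x) : m.inner x (curvature m x X Y Z) U = 0 ↔
      ⟪secondFundamentalForm g x X Z, secondFundamentalForm g x Y U⟫_ℝ =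
        ⟪secondFundamentalForm g x X U, secondFundamentalForm g x Y Z⟫_ℝ := by
    rw [hg.inner_curvature, sub_eq_zero, real_inner_comm, eq_comm]
  refine ⟨fun hR U => (hinner U).1 (by simp [hR]), fun hflat => ?_⟩
  by_contra hR
  exact (m.pos x _ hR).ne' ((hinner _).2 (hflat _))

theorem nullity_eq_gaussNullity (hg : IsIsometricImmersion m g) (x : M) :
    nullity m x = gaussNullity (secondFundamentalForm g x) := by
  refine Submodule.ext fun X => forall_congr' fun Y => ?_
  rw [LinearMap.ext_iff]
  exact forall_congr' fun Z => hg.curvature_eq_zero_iff x X Y Z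

theorem finrank_normalSpace {p : ℕ} {g : M → Euc (n + p)} (hg : IsIsometricImmersion m g) (x : M) :
    Module.finrank ℝ (normalSpace n g x) = p := by
  have hsum := Submodule.finrank_add_finrank_orthogonal
    (LinearMap.range (differential (n := n) g x).toLinearMap)
  rw [LinearMap.finrank_range_of_inj (hg.differential_injective x), finrank_tangentSpace,
    finrank_euclideanSpace_fin] at hsum
  exact Nat.add_left_cancel hsum

variable {p : ℕ} {g : M → Euc (n + p)}

theorem mu_le_nu_add (hg : IsIsometricImmersion m g) (x : M) : mu m x ≤ nu n g x + p := by
  rw [mu, nu, hg.nullity_eq_gaussNullity, relativeNullity_eq_ker]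
  exact (finrank_gaussNullity_le _).trans_eq (by rw [hg.finrank_normalSpace])

theorem nullity_eq_top (hg : IsIsometricImmersion m g) {x : M} (hx : nu n g x + p ≤ mu m x) :
    nullity m x = ⊤ := by
  rw [hg.nullity_eq_gaussNullity, gaussNullity_eq_top_iff]
  refine isFlatBilinear_of_finrank_le (hg.secondFundamentalForm_comm x) ?_
  rwa [hg.finrank_normalSpace, ← relativeNullity_eq_ker, ← hg.nullity_eq_gaussNullity]

end IsIsometricImmersion

end Manifold

end ChernKuiper

theorem mainTheorem6_general {n p : ℕ} {M : Type*} [TopologicalSpace M]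
    [ChartedSpace (ChernKuiper.Euc n) M] [IsManifold (𝓡 n) ∞ M]
    {m : ChernKuiper.Metric n M} {g : M → ChernKuiper.Euc (n + p)}
    (hg : ChernKuiper.IsIsometricImmersion m g) {x : M}
    (hx : ChernKuiper.nu n g x + p ≤ ChernKuiper.mu m x) :
    (∀ X Y Z : TangentSpace (𝓡 n) x, ChernKuiper.curvature m x X Y Z = 0) ∧
      ChernKuiper.mu m x = n ∧ ChernKuiper.nu n g x + p = n := by
  have htop : ChernKuiper.nullity m x = ⊤ := hg.nullity_eq_top hx
  have hmu : ChernKuiper.mu m x = n := by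
    rw [ChernKuiper.mu, htop, finrank_top, ChernKuiper.finrank_tangentSpace]
  exact ⟨fun X Y => LinearMap.congr_fun (Submodule.eq_top_iff'.1 htop X Y), hmu,
    (hx.antisymm (hg.mu_le_nu_add x)).trans hmu⟩

theorem mainTheorem6 {n p : ℕ} {M : Type*} [TopologicalSpace M]
    [ChartedSpace (ChernKuiper.Euc n) M] [IsManifold (𝓡 n) ∞ M]
    (m : ChernKuiper.Metric n M) (g : M → ChernKuiper.Euc (n + p))
    (hg : ChernKuiper.IsIsometricImmersion m g)
    (hμ : ∀ x : M, ChernKuiper.mu m x = ChernKuiper.nu n g x + p) :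
    ChernKuiper.IsFlat m ∧
      ∀ x : M, ChernKuiper.mu m x = n ∧ ChernKuiper.nu n g x + p = n :=
  ⟨fun x => (mainTheorem6_general hg (hμ x).ge).1, fun x => (mainTheorem6_general hg (hμ x).ge).2⟩
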